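/- Let $a,b,c$ be the automorphisms of the ternary rooted tree (acting on finite words over $\{0,1,2\}$, and written in the form $g=\alpha(g_0,g_1,g_2)$, meaning $g(xw)=\alpha(x)\,g_x(w)$) given by $$a=(01)(id,id,a),\qquad b=(02)(id,b,id),\qquad c=(12)(c,id,id);$$ they generate the Hanoi Towers group $H^{(3)}$. For $n\ge 1$ let $\Sigma_n$ be the $n$-th Schreier graph of $H^{(3)}$ with its loops deleted: its vertices are the words of length $n$ over $\{0,1,2\}$, and two distinct words $u,v$ are joined by an edge labelled $g\in\{a,b,c\}$ if $g(u)=v$. The outmost vertices of $\Sigma_n$ are $0^n$ (leftmost), $1^n$ (upmost) and $2^n$ (rightmost). A spanning $k$-forest of $\Sigma_n$ is an acyclic subgraph with the same vertex set and with exactly $k$ connected components. Let $T_n(a,b,c)$ be the generating function of the spanning trees of $\Sigma_n$, each tree being weighted by the product of the weights $a,b,c$ of the labels of its edges. Let $U_n$ (respectively $R_n$, $L_n$) be the analogous generating function of the spanning $2$-forests in which the upmost (respectively rightmost, leftmost) vertex lies in one component and the two other outmost vertices lie in the other component, and let $Q_n$ be that of the spanning $3$-forests in which the three outmost vertices lie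 in three different components. Let $\tau_n$ be the number of spanning trees of $\Sigma_n$, let $s_n$ be the number of spanning $2$-forests of $\Sigma_n$ in which two fixed outmost vertices lie in the same component and the third one lies in the other component, and let $q_n$ be the number of spanning $3$-forests of $\Sigma_n$ in which each component contains exactly one outmost vertex. Then, for every $n\ge 1$, the number $s_n$ does not depend on the choice of the two outmost vertices, $$\tau_n=T_n(1,1,1),\qquad s_n=U_n(1,1,1)=R_n(1,1,1)=L_n(1,1,1),\qquad q_n=Q_n(1,1,1),$$ and $$\tau_{n+1}=3\tau_n^3+6\tau_n^2s_n,$$ $$s_{n+1}=\tau_n^3+7\tau_n^2s_n+7\tau_ns_n^2+\tau_n^2q_n,$$ $$q_{n+1}=3\tau_n^2q_n+12\tau_ns_nq_n+14s_n^3+12\tau_n^2s_n+\tau_n^3+36\tau_ns_n^2,$$ with initial conditions $\tau_1=3$ and $s_1=q_1=1$. -/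

import Mathlib

/-- The three standard generators `a`, `b`, `c` of the Hanoi Towers group `H^(3)`. -/
inductive HanoiGen where
  | a
  | b
  | c

namespace HanoiGen

/-- Action of a generator on the first level of the ternary tree:
`(01)`, `(02)`, `(12)` respectively. -/
def rootPerm : HanoiGen → Equiv.Perm (Fin 3)
  | a => Equiv.swap 0 1
  | b => Equiv.swap 0 2
  | c => Equiv.swap 1 2

/-- The letter `x` at which the restriction of the generator to the subtree rooted at `x` is the
generator itself; at the two other letters the restriction is the identity. -/
def selfLetter : HanoiGen → Fin 3
  | a => 2
  | b => 1
  | c => 0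

/-- The generators as maps on finite words over `{0, 1, 2}`, given by the self-similar form
`a = (01)(id, id, a)`, `b = (02)(id, b, id)`, `c = (12)(c, id, id)`,
where `g = α(g_0, g_1, g_2)` means `g(xw) = α(x) g_x(w)`. -/
def act (g : HanoiGen) : List (Fin 3) → List (Fin 3)
  | [] => []
  | x :: w => g.rootPerm x :: (if x = g.selfLetter then act g w else w)

theorem length_act (g : HanoiGen) (w : List (Fin 3)) : (g.act w).length = w.length := by
  induction w with
  | nil => rfl
  | cons x w ih => by_cases h : x = g.selfLetter <;> simp [act, h, ih]

theorem act_act (g : HanoiGen) (w : List (Fin 3)) : g.act (g.act w) = w := by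
  induction w with
  | nil => rfl
  | cons x w ih =>
    have h1 : g.rootPerm (g.rootPerm x) = x := by cases g <;> simp [rootPerm]
    have h2 : g.rootPerm x = g.selfLetter ↔ x = g.selfLetter := by
      cases g <;> revert x <;> decide
    by_cases h : x = g.selfLetter
    · have h3 := h2.mpr h
      simp only [act, if_pos h, if_pos h3, h1, ih]
    · have h3 := fun h' => h (h2.mp h')
      simp only [act, if_neg h, if_neg h3, h1]

/-- The action of a generator on the `n`-th level of the tree (words of length `n`). -/
def levelAct (g : HanoiGen) {n : ℕ} (v : List.Vector (Fin 3) n) : List.Vector (Fin 3) n :=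
  ⟨g.act v.1, (g.length_act v.1).trans v.2⟩

theorem levelAct_levelAct (g : HanoiGen) {n : ℕ} (v : List.Vector (Fin 3) n) :
    g.levelAct (g.levelAct v) = v :=
  Subtype.ext (g.act_act v.1)

/-- Two different generators never join the same two distinct words, so an edge of the Schreier
graph carries exactly one label. -/
theorem eq_of_act_eq {g h : HanoiGen} {w : List (Fin 3)} (hne : g.act w ≠ w)
    (heq : g.act w = h.act w) : g = h := by
  induction w with
  | nil => exact absurd rfl hne
  | cons x w ih =>
    simp only [act, List.cons.injEq] at heq
    simp only [act, ne_eq, List.cons.injEq] at hne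
    obtain ⟨h1, h2⟩ := heq
    cases g <;> cases h <;> fin_cases x <;>
      simp_all [rootPerm, selfLetter, Equiv.swap_apply_def]

end HanoiGen

/-- The `n`-th Schreier graph `Σ_n` of the Hanoi Towers group, without its loops: the vertices are
the words of length `n` over `{0, 1, 2}`, and two distinct words are adjacent when some generator
maps one to the other. -/
def hanoiGraph (n : ℕ) : SimpleGraph (List.Vector (Fin 3) n) where
  Adj u v := u ≠ v ∧ ∃ g : HanoiGen, g.levelAct u = v
  symm := ⟨by
    rintro u v ⟨hne, g, hg⟩
    exact ⟨hne.symm, g, by rw [← hg, g.levelAct_levelAct]⟩⟩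
  loopless := ⟨fun _ h => h.1 rfl⟩

/-- The outmost vertex `iⁿ` of `Σ_n`: `0ⁿ` is the leftmost one, `1ⁿ` the upmost one and `2ⁿ` the
rightmost one. -/
def hanoiCorner (n : ℕ) (i : Fin 3) : List.Vector (Fin 3) n :=
  List.Vector.replicate n i

/-- `F` is a spanning `k`-forest of `G`: a subgraph of `G` on the whole vertex set of `G` which is
acyclic and has exactly `k` connected components. -/
def IsSpanningForest {V : Type*} (G F : SimpleGraph V) (k : ℕ) : Prop :=
  F ≤ G ∧ F.IsAcyclic ∧ Nat.card F.ConnectedComponent = k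

/-- The spanning trees of `Σ_n`. -/
def hanoiTrees (n : ℕ) : Set (SimpleGraph (List.Vector (Fin 3) n)) :=
  {F | F ≤ hanoiGraph n ∧ F.IsTree}

/-- The spanning 2-forests of `Σ_n` in which the outmost vertex `iⁿ` lies in one component and the
two other outmost vertices lie in the other component. -/
def hanoiTwoForests (n : ℕ) (i : Fin 3) : Set (SimpleGraph (List.Vector (Fin 3) n)) :=
  {F | IsSpanningForest (hanoiGraph n) F 2 ∧
    (∀ j k, j ≠ i → k ≠ i → F.Reachable (hanoiCorner n j) (hanoiCorner n k)) ∧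
    (∀ j, j ≠ i → ¬ F.Reachable (hanoiCorner n i) (hanoiCorner n j))}

/-- The spanning 3-forests of `Σ_n` in which the three outmost vertices lie in three different
components. -/
def hanoiThreeForests (n : ℕ) : Set (SimpleGraph (List.Vector (Fin 3) n)) :=
  {F | IsSpanningForest (hanoiGraph n) F 3 ∧
    ∀ i j, i ≠ j → ¬ F.Reachable (hanoiCorner n i) (hanoiCorner n j)}

open Classical in
/-- The weight of an edge of `Σ_n`: an edge labelled by the generator `a` (resp. `b`, `c`) has
weight `a` (resp. `b`, `c`). -/
noncomputable def hanoiWeight (n : ℕ) (a b c : ℝ) (e : Sym2 (List.Vector (Fin 3) n)) : ℝ :=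
  if ∃ u, e = s(u, HanoiGen.a.levelAct u) then a
  else if ∃ u, e = s(u, HanoiGen.b.levelAct u) then b
  else if ∃ u, e = s(u, HanoiGen.c.levelAct u) then c
  else 0

open Classical in
/-- The weighted generating function `∑_{F ∈ 𝓕} ∏_{e ∈ E(F)} w(e)` of a family `𝓕` of spanning
subgraphs of `Σ_n`. -/
noncomputable def hanoiGenFun (n : ℕ) (𝓕 : Set (SimpleGraph (List.Vector (Fin 3) n)))
    (a b c : ℝ) : ℝ :=
  ∑ F ∈ Finset.univ.filter (· ∈ 𝓕), ∏ e ∈ F.edgeFinset, hanoiWeight n a b c e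

/-- `T_n(a,b,c)`: generating function of the spanning trees of `Σ_n`. -/
noncomputable def hanoiT (n : ℕ) (a b c : ℝ) : ℝ := hanoiGenFun n (hanoiTrees n) a b c

/-- `U_n(a,b,c)`: generating function of the 2-forests separating the upmost vertex from the two
other outmost vertices. -/
noncomputable def hanoiU (n : ℕ) (a b c : ℝ) : ℝ := hanoiGenFun n (hanoiTwoForests n 1) a b c

/-- `R_n(a,b,c)`: generating function of the 2-forests separating the rightmost vertex from the two
other outmost vertices. -/
noncomputable def hanoiR (n : ℕ) (a b c : ℝ) : ℝ := hanoiGenFun n (hanoiTwoForests n 2) a b c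

/-- `L_n(a,b,c)`: generating function of the 2-forests separating the leftmost vertex from the two
other outmost vertices. -/
noncomputable def hanoiL (n : ℕ) (a b c : ℝ) : ℝ := hanoiGenFun n (hanoiTwoForests n 0) a b c

/-- `Q_n(a,b,c)`: generating function of the 3-forests separating the three outmost vertices. -/
noncomputable def hanoiQ (n : ℕ) (a b c : ℝ) : ℝ := hanoiGenFun n (hanoiThreeForests n) a b c

/-- `τ_n`: the complexity (number of spanning trees) of `Σ_n`. -/
noncomputable def hanoiTau (n : ℕ) : ℕ := (hanoiTrees n).ncard

/-- `s_n`: the number of spanning 2-forests of `Σ_n` in which two fixed outmost vertices lie in the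
same component and the third one lies in the other component. The definition takes `1ⁿ` as the
third vertex; that the choice is immaterial is a claim to be proved. -/
noncomputable def hanoiS (n : ℕ) : ℕ := (hanoiTwoForests n 1).ncard

/-- `q_n`: the number of spanning 3-forests of `Σ_n` in which each component contains exactly one
outmost vertex. -/
noncomputable def hanoiQCount (n : ℕ) : ℕ := (hanoiThreeForests n).ncard

/-!
Sort the words of length `n + 1` by their last letter `k`: `Σ_{n+1}` is three copies of `Σ_n`
joined by three bridges, the `k`-th of which joins the corners `kⁿ` of the two copies other than
the `k`-th. Call a forest a grove if each of its components contains a corner; the forests counted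
by `τ_n`, `s_n`, `q_n` are the groves whose connection relation on the three corners has one, two
or three classes. A subgraph of `Σ_{n+1}` is three subgraphs of `Σ_n` and a set of bridges, and
whether it is a grove, and with which connection relation on the new corners, depends only on the
bridges and on the connection relations of the three pieces. The recursion is therefore a finite
enumeration, which is invariant under permuting the corners; by induction from `n = 0` the numbers
of groves depend only on the number of classes.
-/

section Groves

variable {ι V V' : Type*}

/-- The connection relation which a graph `F` induces on the nodes `κ i`. -/
def nodeRel (F : SimpleGraph V) (κ : ι → V) (i j : ι) : Prop :=
  F.Reachable (κ i) (κ j)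

theorem nodeRel_equivalence (F : SimpleGraph V) (κ : ι → V) : Equivalence (nodeRel F κ) :=
  ⟨fun _ => .rfl, .symm, .trans⟩

/-- The groves of `G` with nodes `κ i` and connection relation `r`, in the sense of Kenyon and
Wilson: the spanning forests of `G` all of whose components contain a node and which connect two
nodes exactly when `r` relates their indices. -/
def groves (G : SimpleGraph V) (κ : ι → V) (r : ι → ι → Prop) : Set (SimpleGraph V) :=
  {F | F ≤ G ∧ F.IsAcyclic ∧ (∀ v, ∃ i, F.Reachable v (κ i)) ∧ nodeRel F κ = r}

theorem forall_exists_reachable_iff_card_connectedComponent [Finite V] (F : SimpleGraph V)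
    (κ : ι → V) :
    (∀ v, ∃ i, F.Reachable v (κ i)) ↔
      Nat.card F.ConnectedComponent = Nat.card (Quot (nodeRel F κ)) := by
  let component : Quot (nodeRel F κ) → F.ConnectedComponent :=
    Quot.lift (fun i => F.connectedComponentMk (κ i))
      fun _ _ h => SimpleGraph.ConnectedComponent.sound h
  have component_injective : component.Injective := by
    rintro ⟨i⟩ ⟨j⟩ h
    exact Quot.sound (SimpleGraph.ConnectedComponent.exact h)
  have component_surjective_iff :
      component.Surjective ↔ ∀ v, ∃ i, F.Reachable v (κ i) := by
    rw [Function.Surjective, SimpleGraph.ConnectedComponent.forall]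
    refine forall_congr' fun v => Quot.mk_surjective.exists.trans (exists_congr fun i => ?_)
    exact SimpleGraph.ConnectedComponent.eq.trans SimpleGraph.reachable_comm
  have := Finite.of_injective component component_injective
  rw [← component_surjective_iff]
  constructor
  · exact fun h => (Nat.card_eq_of_bijective component ⟨component_injective, h⟩).symm
  · exact fun h => ((Nat.bijective_iff_injective_and_card component).2
      ⟨component_injective, h.symm⟩).surjective

theorem mem_groves_iff_isSpanningForest [Finite V] {G F : SimpleGraph V} {κ : ι → V}
    {r : ι → ι → Prop} :
    F ∈ groves G κ r ↔ IsSpanningForest G F (Nat.card (Quot r)) ∧ nodeRel F κ = r := by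
  simp only [groves, IsSpanningForest, Set.mem_ofPred_eq, and_assoc,
    forall_exists_reachable_iff_card_connectedComponent]
  refine and_congr_right fun _ => and_congr_right fun _ => and_congr_left ?_
  rintro rfl
  rfl

theorem ncard_groves_congr {G : SimpleGraph V} {G' : SimpleGraph V'} (φ : G ≃g G') (κ : ι → V)
    (r : ι → ι → Prop) : (groves G κ r).ncard = (groves G' (φ ∘ κ) r).ncard := by
  refine Set.ncard_congr' (φ.toEquiv.simpleGraph.subtypeEquiv fun F => ?_)
  let ψ : F ≃g φ.toEquiv.simpleGraph F := (SimpleGraph.Iso.comap φ.symm.toEquiv F).symm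
  have hle : φ.toEquiv.simpleGraph F ≤ G' ↔ F ≤ G := by
    constructor
    · exact fun h u v huv => φ.map_adj_iff.1 (h (ψ.map_adj_iff.2 huv))
    · exact fun h u v huv => φ.symm.map_adj_iff.1 (h huv)
  have hspan : (∀ v, ∃ i, (φ.toEquiv.simpleGraph F).Reachable v (φ (κ i))) ↔
      ∀ v, ∃ i, F.Reachable v (κ i) :=
    ψ.surjective.forall.trans (forall_congr' fun v => exists_congr fun i => ψ.reachable_iff)
  have hrel : nodeRel (φ.toEquiv.simpleGraph F) (φ ∘ κ) = nodeRel F κ := by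
    funext i j
    exact propext ψ.reachable_iff
  simp only [groves, Set.mem_ofPred_eq, hle, hrel, ← ψ.isAcyclic_iff, Function.comp_apply, hspan]

end Groves

section AddEdges

variable {ι V : Type*}

theorem reachable_sup_edge_iff {F : SimpleGraph V} {u v x y : V} :
    (F ⊔ SimpleGraph.edge u v).Reachable x y ↔
      F.Reachable x y ∨ F.Reachable x u ∧ F.Reachable v y ∨ F.Reachable x v ∧ F.Reachable u y := by
  constructor
  · intro h
    rw [SimpleGraph.reachable_iff_reflTransGen] at h
    induction h with
    | refl => exact .inl .rfl
    | @tail y z _ hyz ih =>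
      rw [SimpleGraph.sup_adj, SimpleGraph.edge_adj] at hyz
      rcases hyz with hyz | ⟨⟨rfl, rfl⟩ | ⟨rfl, rfl⟩, -⟩
      · exact ih.imp (·.trans hyz.reachable)
          (.imp (.imp_right (·.trans hyz.reachable)) (.imp_right (·.trans hyz.reachable)))
      · rcases ih with h | ⟨h, -⟩ | ⟨h, -⟩
        exacts [.inr (.inl ⟨h, .rfl⟩), .inr (.inl ⟨h, .rfl⟩), .inl h]
      · rcases ih with h | ⟨h, -⟩ | ⟨h, -⟩
        exacts [.inr (.inr ⟨h, .rfl⟩), .inl h, .inr (.inr ⟨h, .rfl⟩)]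
  · have hle : F ≤ F ⊔ SimpleGraph.edge u v := le_sup_left
    have huv : (F ⊔ SimpleGraph.edge u v).Reachable u v := by
      by_cases h : u = v
      · rw [h]
      · exact SimpleGraph.Adj.reachable (.inr ((SimpleGraph.edge_adj ..).2 ⟨.inl ⟨rfl, rfl⟩, h⟩))
    rintro (h | ⟨h, h'⟩ | ⟨h, h'⟩)
    · exact h.mono hle
    · exact (h.mono hle).trans (huv.trans (h'.mono hle))
    · exact (h.mono hle).trans (huv.symm.trans (h'.mono hle))

/-- The relation obtained from an equivalence relation `r` by merging the classes of the two ends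
of the edge `e`. -/
def linkRel (r : ι → ι → Prop) (e : ι × ι) (x y : ι) : Prop :=
  r x y ∨ r x e.1 ∧ r e.2 y ∨ r x e.2 ∧ r e.1 y

/-- The relation obtained from an equivalence relation by merging successively the classes of the
two ends of each edge of a list. -/
def linkAll (r : ι → ι → Prop) (l : List (ι × ι)) : ι → ι → Prop :=
  l.foldl linkRel r

/-- A list of edges is independent over an equivalence relation if each of them joins two different
classes of the relation in which the classes of the ends of all its predecessors are merged: the
edges then form a forest on the classes. -/
def IsIndependent (r : ι → ι → Prop) : List (ι × ι) → Prop
  | [] => True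
  | e :: l => ¬ r e.1 e.2 ∧ IsIndependent (linkRel r e) l

instance linkRel.decidableRel (r : ι → ι → Prop) [DecidableRel r] (e : ι × ι) :
    DecidableRel (linkRel r e) :=
  fun _ _ => inferInstanceAs (Decidable (_ ∨ _ ∧ _ ∨ _ ∧ _))

instance linkAll.decidableRel (r : ι → ι → Prop) [DecidableRel r] :
    ∀ l, DecidableRel (linkAll r l)
  | [] => inferInstanceAs (DecidableRel r)
  | e :: l => linkAll.decidableRel (linkRel r e) l

instance IsIndependent.decidable (r : ι → ι → Prop) [DecidableRel r] :
    ∀ l, Decidable (IsIndependent r l)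
  | [] => inferInstanceAs (Decidable True)
  | e :: l =>
    have := IsIndependent.decidable (linkRel r e) l
    inferInstanceAs (Decidable (¬ _ ∧ _))

/-- The graph `F` with the edges between `κ e.1` and `κ e.2` added for `e` in a list. -/
def addEdges (κ : ι → V) (F : SimpleGraph V) (l : List (ι × ι)) : SimpleGraph V :=
  l.foldl (fun F e => F ⊔ SimpleGraph.edge (κ e.1) (κ e.2)) F

theorem addEdges_adj {κ : ι → V} {F : SimpleGraph V} {l : List (ι × ι)} {x y : V} :
    (addEdges κ F l).Adj x y ↔
      F.Adj x y ∨ ∃ e ∈ l, (SimpleGraph.edge (κ e.1) (κ e.2)).Adj x y := by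
  induction l generalizing F with
  | nil => simp [addEdges]
  | cons e l ih =>
    exact ih.trans (by simp only [SimpleGraph.sup_adj, or_assoc, List.exists_mem_cons_iff])

theorem nodeRel_sup_edge (κ : ι → V) (F : SimpleGraph V) (e : ι × ι) :
    nodeRel (F ⊔ SimpleGraph.edge (κ e.1) (κ e.2)) κ = linkRel (nodeRel F κ) e := by
  funext x y
  exact propext reachable_sup_edge_iff

theorem nodeRel_addEdges (κ : ι → V) (F : SimpleGraph V) (l : List (ι × ι)) :
    nodeRel (addEdges κ F l) κ = linkAll (nodeRel F κ) l := by
  induction l generalizing F with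
  | nil => rfl
  | cons e l ih => exact (ih _).trans (congrArg (linkAll · l) (nodeRel_sup_edge κ F e))

theorem exists_reachable_addEdges_iff {κ : ι → V} {F : SimpleGraph V} {l : List (ι × ι)} {v : V} :
    (∃ x, (addEdges κ F l).Reachable v (κ x)) ↔ ∃ x, F.Reachable v (κ x) := by
  induction l generalizing F with
  | nil => rfl
  | cons e l ih =>
    refine ih.trans ⟨?_, fun ⟨x, h⟩ => ⟨x, h.mono le_sup_left⟩⟩
    rintro ⟨x, h⟩
    rcases reachable_sup_edge_iff.1 h with h | ⟨h, -⟩ | ⟨h, -⟩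
    exacts [⟨x, h⟩, ⟨e.1, h⟩, ⟨e.2, h⟩]

theorem isAcyclic_addEdges_iff {κ : ι → V} {F : SimpleGraph V} {l : List (ι × ι)}
    (hnodup : (l.map fun e => s(κ e.1, κ e.2)).Nodup) (hne : ∀ e ∈ l, κ e.1 ≠ κ e.2)
    (hF : ∀ e ∈ l, ¬ F.Adj (κ e.1) (κ e.2)) :
    (addEdges κ F l).IsAcyclic ↔ F.IsAcyclic ∧ IsIndependent (nodeRel F κ) l := by
  induction l generalizing F with
  | nil => exact (and_iff_left trivial).symm
  | cons e l ih =>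
    simp only [List.map_cons, List.nodup_cons, List.mem_map, not_exists, not_and,
      List.forall_mem_cons] at hnodup hne hF
    have hnew : ∀ e' ∈ l,
        ¬ (F ⊔ SimpleGraph.edge (κ e.1) (κ e.2)).Adj (κ e'.1) (κ e'.2) := by
      rintro e' he' (h | h)
      · exact hF.2 e' he' h
      · exact hnodup.1 e' he' (Sym2.eq_iff.2 (((SimpleGraph.edge_adj ..).1 h).1))
    have hedge : (F ⊔ SimpleGraph.edge (κ e.1) (κ e.2)).IsAcyclic ↔
        F.IsAcyclic ∧ ¬ nodeRel F κ e.1 e.2 := by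
      simp only [SimpleGraph.isAcyclic_sup_fromEdgeSet_iff, hne.1, hF.1, or_self, imp_false,
        nodeRel]
    rw [IsIndependent, ← and_assoc, ← hedge, ← nodeRel_sup_edge]
    exact ih hnodup.2 hne.2 hnew

end AddEdges

section DisjointUnion

variable {I ι V : Type*}

/-- The disjoint union of the graphs `A i`, all of them on the same vertex type; the vertex `v` of
`A i` becomes `(i, v)`. -/
def disjointUnion (A : I → SimpleGraph V) : SimpleGraph (I × V) where
  Adj x y := x.1 = y.1 ∧ (A x.1).Adj x.2 y.2
  symm := ⟨by
    rintro ⟨i, u⟩ ⟨_, v⟩ ⟨rfl, h⟩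
    exact ⟨rfl, h.symm⟩⟩
  loopless := ⟨fun _ h => h.2.ne rfl⟩

/-- The relation on the nodes of a disjoint union which is `p i` on the nodes of the `i`-th part. -/
def disjointRel (p : I → ι → ι → Prop) (x y : I × ι) : Prop :=
  x.1 = y.1 ∧ p x.1 x.2 y.2

instance disjointRel.decidableRel [DecidableEq I] (p : I → ι → ι → Prop)
    [∀ i, DecidableRel (p i)] : DecidableRel (disjointRel p) :=
  fun _ _ => inferInstanceAs (Decidable (_ ∧ _))

theorem reachable_disjointUnion_iff {A : I → SimpleGraph V} {x y : I × V} :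
    (disjointUnion A).Reachable x y ↔ x.1 = y.1 ∧ (A x.1).Reachable x.2 y.2 := by
  constructor
  · intro h
    rw [SimpleGraph.reachable_iff_reflTransGen] at h
    induction h with
    | refl => exact ⟨rfl, .rfl⟩
    | tail _ hyz ih => exact ⟨ih.1.trans hyz.1, ih.2.trans (ih.1 ▸ hyz.2.reachable)⟩
  · obtain ⟨i, u⟩ := x
    obtain ⟨j, v⟩ := y
    rintro ⟨rfl, h⟩
    exact h.map (⟨Prod.mk i, fun h => ⟨rfl, h⟩⟩ : A i →g disjointUnion A)

theorem nodeRel_disjointUnion (A : I → SimpleGraph V) (κ : ι → V) :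
    nodeRel (disjointUnion A) (Prod.map id κ) = disjointRel fun i => nodeRel (A i) κ := by
  funext x y
  exact propext reachable_disjointUnion_iff

theorem exists_reachable_disjointUnion_iff {A : I → SimpleGraph V} {κ : ι → V} {x : I × V} :
    (∃ y, (disjointUnion A).Reachable x (Prod.map id κ y)) ↔ ∃ j, (A x.1).Reachable x.2 (κ j) := by
  simp only [reachable_disjointUnion_iff, Prod.exists, Prod.map_apply, id_eq, exists_and_left,
    exists_eq_left']

theorem isAcyclic_disjointUnion_iff {A : I → SimpleGraph V} :
    (disjointUnion A).IsAcyclic ↔ ∀ i, (A i).IsAcyclic := by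
  constructor
  · exact fun h i => h.comap (⟨Prod.mk i, fun h => ⟨rfl, h⟩⟩ : A i →g disjointUnion A)
      (Prod.mk_right_injective i)
  · intro h
    rw [SimpleGraph.isAcyclic_iff_forall_adj_isBridge]
    rintro ⟨i, u⟩ ⟨_, v⟩ ⟨rfl, huv⟩
    have hbridge := SimpleGraph.isAcyclic_iff_forall_adj_isBridge.1 (h i) huv
    rw [SimpleGraph.isBridge_iff] at hbridge ⊢
    refine mt (fun hreach => ?_) hbridge
    suffices ∀ y, ((disjointUnion A).deleteEdges {s((i, u), (i, v))}).Reachable (i, u) y →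
        y.1 = i ∧ ((A i).deleteEdges {s(u, v)}).Reachable u y.2 from (this _ hreach).2
    intro y hy
    rw [SimpleGraph.reachable_iff_reflTransGen] at hy
    induction hy with
    | refl => exact ⟨rfl, .rfl⟩
    | @tail y z _ hyz ih =>
      obtain ⟨j, y⟩ := y
      obtain ⟨k, z⟩ := z
      obtain ⟨rfl, hreach⟩ := ih
      rw [SimpleGraph.deleteEdges_adj] at hyz
      obtain ⟨⟨rfl, hadj⟩, hne⟩ := hyz
      refine ⟨rfl, hreach.trans (SimpleGraph.Adj.reachable ?_)⟩
      rw [SimpleGraph.deleteEdges_adj]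
      exact ⟨hadj, fun h => hne (congrArg (Sym2.map (Prod.mk j)) h)⟩

end DisjointUnion

section Glue

variable {V : Type*}

/-- The bridges of `glue` with indices in `S`, as a list: the `k`-th bridge joins the `k`-th nodes
of the copies `k + 1` and `k + 2` (modulo 3). -/
def bridges (S : Finset (Fin 3)) : List ((Fin 3 × Fin 3) × (Fin 3 × Fin 3)) :=
  ((List.finRange 3).filter (· ∈ S)).map fun k => ((k + 1, k), (k + 2, k))

/-- Three graphs with three nodes each, glued along the bridges with indices in `S`. -/
def glue (κ : Fin 3 → V) (A : Fin 3 → SimpleGraph V) (S : Finset (Fin 3)) :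
    SimpleGraph (Fin 3 × V) :=
  addEdges (Prod.map id κ) (disjointUnion A) (bridges S)

/-- Gluing three groves with connection relations `p i` along the bridges with indices in `S` gives
a grove with nodes the `i`-th node of the `i`-th copy and connection relation `t`. -/
def GluesTo (p : Fin 3 → Fin 3 → Fin 3 → Prop) (S : Finset (Fin 3)) (t : Fin 3 → Fin 3 → Prop) :
    Prop :=
  IsIndependent (disjointRel p) (bridges S) ∧
    (∀ i j, ∃ k, linkAll (disjointRel p) (bridges S) (i, j) (k, k)) ∧
    ∀ i j, linkAll (disjointRel p) (bridges S) (i, i) (j, j) ↔ t i j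

instance GluesTo.decidable (p : Fin 3 → Fin 3 → Fin 3 → Prop) [∀ i, DecidableRel (p i)]
    (S : Finset (Fin 3)) (t : Fin 3 → Fin 3 → Prop) [DecidableRel t] :
    Decidable (GluesTo p S t) :=
  inferInstanceAs (Decidable (_ ∧ _ ∧ _))

theorem add_one_ne_add_two (k : Fin 3) : k + 1 ≠ k + 2 := by
  revert k
  decide

theorem sym2_add_one_add_two_injective :
    Function.Injective fun k : Fin 3 => s(k + 1, k + 2) := by
  decide

variable {κ : Fin 3 → V} {G A B : Fin 3 → SimpleGraph V} {S T : Finset (Fin 3)}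

theorem forall_mem_bridges {P : (Fin 3 × Fin 3) × (Fin 3 × Fin 3) → Prop} :
    (∀ e ∈ bridges S, P e) ↔ ∀ k ∈ S, P ((k + 1, k), (k + 2, k)) := by
  simp [bridges]

theorem nodup_map_bridges :
    ((bridges S).map fun e => s(Prod.map id κ e.1, Prod.map id κ e.2)).Nodup := by
  rw [bridges, List.map_map]
  refine ((List.nodup_finRange 3).filter _).map fun k l h => sym2_add_one_add_two_injective ?_
  exact congrArg (Sym2.map Prod.fst) h

theorem glue_adj {x y : Fin 3 × V} :
    (glue κ A S).Adj x y ↔ (x.1 = y.1 ∧ (A x.1).Adj x.2 y.2) ∨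
      ∃ k ∈ S, s(x, y) = s((k + 1, κ k), (k + 2, κ k)) := by
  rw [glue, addEdges_adj]
  refine or_congr_right ?_
  simp only [bridges, List.mem_map, List.mem_filter, List.mem_finRange, true_and,
    decide_eq_true_eq, exists_exists_and_eq_and, Prod.map_apply, id_eq, SimpleGraph.edge_adj]
  refine exists_congr fun k => and_congr_right fun _ => ?_
  rw [Sym2.eq_iff]
  refine and_iff_left_of_imp ?_
  rintro (⟨rfl, rfl⟩ | ⟨rfl, rfl⟩) h
  · exact add_one_ne_add_two k (congrArg Prod.fst h)
  · exact add_one_ne_add_two k (congrArg Prod.fst h).symm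

theorem glue_adj_mk_mk {i : Fin 3} {u v : V} :
    (glue κ A S).Adj (i, u) (i, v) ↔ (A i).Adj u v := by
  rw [glue_adj, or_iff_left]
  · exact and_iff_right rfl
  · rintro ⟨k, -, h⟩
    have hdiag : s(i, i) = s(k + 1, k + 2) := congrArg (Sym2.map Prod.fst) h
    exact add_one_ne_add_two k (Sym2.mk_isDiag_iff.1 (hdiag ▸ Sym2.mk_isDiag_iff.2 rfl))

theorem glue_adj_bridge {k : Fin 3} :
    (glue κ A S).Adj (k + 1, κ k) (k + 2, κ k) ↔ k ∈ S := by
  rw [glue_adj, or_iff_right fun h => add_one_ne_add_two k h.1]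
  constructor
  · rintro ⟨l, hl, h⟩
    exact sym2_add_one_add_two_injective (congrArg (Sym2.map Prod.fst) h) ▸ hl
  · exact fun h => ⟨k, h, rfl⟩

theorem glue_inj : glue κ A S = glue κ B T ↔ A = B ∧ S = T := by
  constructor
  · intro h
    constructor
    · ext i u v
      rw [← glue_adj_mk_mk (κ := κ) (S := S), h, glue_adj_mk_mk]
    · ext k
      rw [← glue_adj_bridge (κ := κ) (A := A), h, glue_adj_bridge]
  · rintro ⟨rfl, rfl⟩
    rfl

theorem glue_le_glue_univ_iff : glue κ A S ≤ glue κ G Finset.univ ↔ ∀ i, A i ≤ G i := by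
  constructor
  · exact fun h i u v huv => glue_adj_mk_mk.1 (h (glue_adj_mk_mk.2 huv))
  · intro h x y hxy
    exact glue_adj.2 ((glue_adj.1 hxy).imp (.imp_right (h _ ·))
      fun ⟨k, _, hk⟩ => ⟨k, Finset.mem_univ k, hk⟩)

open Classical in
theorem exists_eq_glue {F : SimpleGraph (Fin 3 × V)} (hF : F ≤ glue κ G Finset.univ) :
    ∃ A S, F = glue κ A S := by
  refine ⟨fun i => F.comap (Prod.mk i),
    Finset.univ.filter fun k => F.Adj (k + 1, κ k) (k + 2, κ k), ?_⟩
  ext x y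
  rw [glue_adj]
  constructor
  · intro h
    refine (glue_adj.1 (hF h)).imp ?_ ?_
    · obtain ⟨i, u⟩ := x
      obtain ⟨_, v⟩ := y
      rintro ⟨rfl, -⟩
      exact ⟨rfl, h⟩
    · rintro ⟨k, -, hk⟩
      rw [← SimpleGraph.mem_edgeSet, hk] at h
      exact ⟨k, by simpa using h, hk⟩
  · rintro (⟨h, hadj⟩ | ⟨k, hk, h⟩)
    · obtain ⟨i, u⟩ := x
      obtain ⟨_, v⟩ := y
      obtain rfl := h
      exact hadj
    · rw [← SimpleGraph.mem_edgeSet, h]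
      simpa using hk

theorem nodeRel_glue :
    nodeRel (glue κ A S) (Prod.map id κ) =
      linkAll (disjointRel fun i => nodeRel (A i) κ) (bridges S) := by
  rw [glue, nodeRel_addEdges, nodeRel_disjointUnion]

theorem isAcyclic_glue_iff :
    (glue κ A S).IsAcyclic ↔ (∀ i, (A i).IsAcyclic) ∧
      IsIndependent (disjointRel fun i => nodeRel (A i) κ) (bridges S) := by
  rw [glue, isAcyclic_addEdges_iff nodup_map_bridges, isAcyclic_disjointUnion_iff,
    nodeRel_disjointUnion]
  · exact forall_mem_bridges.2 fun k _ h => add_one_ne_add_two k (congrArg Prod.fst h)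
  · exact forall_mem_bridges.2 fun k _ h => add_one_ne_add_two k h.1

theorem forall_exists_reachable_glue_iff :
    (∀ v, ∃ i, (glue κ A S).Reachable v (i, κ i)) ↔
      (∀ i v, ∃ j, (A i).Reachable v (κ j)) ∧
        ∀ i j, ∃ k, nodeRel (glue κ A S) (Prod.map id κ) (i, j) (k, k) := by
  have hnode : ∀ {v}, (∃ x, (glue κ A S).Reachable v (Prod.map id κ x)) ↔
      ∃ j, (A v.1).Reachable v.2 (κ j) :=
    exists_reachable_addEdges_iff.trans exists_reachable_disjointUnion_iff
  constructor
  · refine fun h => ⟨fun i v => (hnode (v := (i, v))).1 ?_, fun i j => h (i, κ j)⟩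
    obtain ⟨j, hj⟩ := h (i, v)
    exact ⟨(j, j), hj⟩
  · rintro ⟨hA, hglue⟩ v
    obtain ⟨x, hx⟩ := hnode.2 (hA v.1 v.2)
    obtain ⟨i, hi⟩ := hglue x.1 x.2
    exact ⟨i, hx.trans hi⟩

theorem glue_mem_groves_iff {t : Fin 3 → Fin 3 → Prop} :
    glue κ A S ∈ groves (glue κ G Finset.univ) (fun i => (i, κ i)) t ↔
      (∀ i, A i ∈ groves (G i) κ (nodeRel (A i) κ)) ∧ GluesTo (fun i => nodeRel (A i) κ) S t := by
  have hrel : nodeRel (glue κ A S) (fun i => (i, κ i)) = t ↔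
      ∀ i j, nodeRel (glue κ A S) (Prod.map id κ) (i, i) (j, j) ↔ t i j := by
    simp only [funext_iff, eq_iff_iff]
    rfl
  simp only [groves, GluesTo, Set.mem_ofPred_eq, glue_le_glue_univ_iff, isAcyclic_glue_iff,
    forall_exists_reachable_glue_iff, hrel, nodeRel_glue, forall_and, and_true]
  tauto

end Glue

/-- The partitions of a set of three elements: the one with one block, those in which `i` is alone
and the two other elements form a block, and the one with three blocks. -/
inductive ThreePartition where
  | joined
  | isolating (i : Fin 3)
  | discrete
  deriving DecidableEq, Fintype

namespace ThreePartition

/-- The equivalence relation whose classes are the blocks of a partition. -/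
def rel : ThreePartition → Fin 3 → Fin 3 → Prop
  | joined, _, _ => True
  | isolating i, j, k => j = i ↔ k = i
  | discrete, j, k => j = k

instance rel.decidableRel : ∀ p : ThreePartition, DecidableRel p.rel
  | joined => fun _ _ => inferInstanceAs (Decidable True)
  | isolating _ => fun _ _ => inferInstanceAs (Decidable (_ ↔ _))
  | discrete => fun _ _ => inferInstanceAs (Decidable (_ = _))

/-- The number of blocks of a partition, minus one. -/
def kind : ThreePartition → Fin 3
  | joined => 0
  | isolating _ => 1
  | discrete => 2

theorem equivalence_rel (p : ThreePartition) : Equivalence p.rel where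
  refl := by revert p; decide
  symm := by revert p; decide
  trans := by revert p; decide

instance fintypeQuot (p : ThreePartition) : Fintype (Quot p.rel) :=
  @Quotient.fintype (Fin 3) _ ⟨p.rel, p.equivalence_rel⟩ (rel.decidableRel p)

theorem natCard_quot_rel (p : ThreePartition) : Nat.card (Quot p.rel) = p.kind + 1 := by
  rw [Nat.card_eq_fintype_card]
  revert p
  decide

theorem rel_injective : Function.Injective rel := by
  have h : ∀ p q : ThreePartition, (∀ i j, p.rel i j ↔ q.rel i j) → p = q := by decide
  exact fun p q hpq => h p q fun i j => by rw [hpq]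

theorem exists_rel_eq {r : Fin 3 → Fin 3 → Prop} (hr : Equivalence r) :
    ∃ p : ThreePartition, p.rel = r := by
  have symm : ∀ i j, r i j ↔ r j i := fun i j => ⟨hr.symm, hr.symm⟩
  suffices ∃ p : ThreePartition, (p.rel 0 1 ↔ r 0 1) ∧ (p.rel 0 2 ↔ r 0 2) ∧ (p.rel 1 2 ↔ r 1 2) by
    obtain ⟨p, h01, h02, h12⟩ := this
    have symm' : ∀ i j, p.rel i j ↔ p.rel j i :=
      fun i j => ⟨p.equivalence_rel.symm, p.equivalence_rel.symm⟩
    refine ⟨p, funext₂ ?_⟩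
    simp [Fin.forall_fin_succ, hr.refl, p.equivalence_rel.refl, symm 1 0, symm 2 0, symm 2 1,
      symm' 1 0, symm' 2 0, symm' 2 1, *]
  by_cases h01 : r 0 1 <;> by_cases h02 : r 0 2 <;> by_cases h12 : r 1 2
  · exact ⟨joined, by simp [rel, *]⟩
  · exact absurd (hr.trans (hr.symm h01) h02) h12
  · exact absurd (hr.trans h01 h12) h02
  · exact ⟨isolating 2, by simp [rel, *]⟩
  · exact absurd (hr.trans h02 (hr.symm h12)) h01
  · exact ⟨isolating 1, by simp [rel, *]⟩
  · exact ⟨isolating 0, by simp [rel, *]⟩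
  · exact ⟨discrete, by simp [rel, *]⟩

end ThreePartition

/-- The ways to glue three groves into a grove with connection relation `t`: the connection
relations of the three groves and the set of the bridges along which they are glued. -/
def gluings (t : ThreePartition) : Finset ((Fin 3 → ThreePartition) × Finset (Fin 3)) :=
  {x | GluesTo (fun i => (x.1 i).rel) x.2 t.rel}

open Classical in
theorem ncard_groves_glue {V : Type*} [Finite V] (G : Fin 3 → SimpleGraph V) (κ : Fin 3 → V)
    (t : ThreePartition) :
    (groves (glue κ G Finset.univ) (fun i => (i, κ i)) t.rel).ncard =
      ∑ x ∈ gluings t, ∏ i, (groves (G i) κ (x.1 i).rel).ncard := by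
  have := Fintype.ofFinite V
  simp only [Set.ncard_eq_toFinset_card', ← Fintype.card_piFinset]
  rw [← Finset.card_sigma]
  symm
  refine Finset.card_bij (fun y _ => glue κ y.2 y.1.2) ?_ ?_ ?_ <;>
    simp only [Finset.mem_sigma, gluings, Finset.mem_filter, Finset.mem_univ, true_and,
      Fintype.mem_piFinset, Set.mem_toFinset]
  · rintro ⟨⟨p, S⟩, A⟩ ⟨hglue, hA⟩
    have hp : ∀ i, (p i).rel = nodeRel (A i) κ := fun i => (hA i).2.2.2.symm
    simp only [hp] at hglue hA
    exact glue_mem_groves_iff.2 ⟨hA, hglue⟩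
  · rintro ⟨⟨p, S⟩, A⟩ ⟨-, hA⟩ ⟨⟨q, T⟩, B⟩ ⟨-, hB⟩ h
    obtain ⟨rfl, rfl⟩ := glue_inj.1 h
    obtain rfl : p = q := funext fun i =>
      ThreePartition.rel_injective ((hA i).2.2.2.symm.trans (hB i).2.2.2)
    rfl
  · intro F hF
    obtain ⟨A, S, rfl⟩ := exists_eq_glue hF.1
    obtain ⟨hA, hglue⟩ := glue_mem_groves_iff.1 hF
    choose p hp using fun i => ThreePartition.exists_rel_eq (nodeRel_equivalence (A i) κ)
    simp only [← hp] at hA hglue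
    exact ⟨⟨(p, S), A⟩, ⟨hglue, hA⟩, rfl⟩

/-- The kinds of three partitions, without their order. -/
def kinds (p : Fin 3 → ThreePartition) : Multiset (Fin 3) :=
  Finset.univ.val.map fun i => (p i).kind

/-- The kinds of the partitions in the gluings that give a partition of kind `k`; each term is a
monomial of the recursion formulas, with its coefficient. -/
def gluingKinds (k : Fin 3) : Multiset (Multiset (Fin 3)) :=
  match k with
  | 0 => .replicate 3 {0, 0, 0} + .replicate 6 {0, 0, 1}
  | 1 => .replicate 1 {0, 0, 0} + .replicate 7 {0, 0, 1} + .replicate 7 {0, 1, 1} +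
      .replicate 1 {0, 0, 2}
  | 2 => .replicate 3 {0, 0, 2} + .replicate 12 {0, 1, 2} + .replicate 14 {1, 1, 1} +
      .replicate 12 {0, 0, 1} + .replicate 1 {0, 0, 0} + .replicate 36 {0, 1, 1}

set_option maxRecDepth 100000 in
theorem map_kinds_gluings (t : ThreePartition) :
    (gluings t).val.map (fun x => kinds x.1) = gluingKinds t.kind := by
  revert t
  decide +kernel

/-- The numbers of groves of each kind of three glued copies, as a function of the numbers `f` of
groves of each kind of one copy. -/
def gluingStep (f : Fin 3 → ℕ) : Fin 3 → ℕ :=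
  ![3 * f 0 ^ 3 + 6 * f 0 ^ 2 * f 1,
    f 0 ^ 3 + 7 * f 0 ^ 2 * f 1 + 7 * f 0 * f 1 ^ 2 + f 0 ^ 2 * f 2,
    3 * f 0 ^ 2 * f 2 + 12 * f 0 * f 1 * f 2 + 14 * f 1 ^ 3 + 12 * f 0 ^ 2 * f 1 + f 0 ^ 3 +
      36 * f 0 * f 1 ^ 2]

theorem sum_gluingKinds (f : Fin 3 → ℕ) (k : Fin 3) :
    ((gluingKinds k).map fun m => (m.map f).prod).sum = gluingStep f k := by
  match k with
  | 0 | 1 | 2 =>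
    simp only [gluingKinds, Multiset.map_add, Multiset.map_replicate, Multiset.sum_add,
      Multiset.sum_replicate, Multiset.insert_eq_cons, Multiset.map_cons, Multiset.map_singleton,
      Multiset.prod_cons, Multiset.prod_singleton, smul_eq_mul]
    simp only [gluingStep, Matrix.cons_val]
    ring

theorem sum_gluings (f : Fin 3 → ℕ) (t : ThreePartition) :
    ∑ x ∈ gluings t, ∏ i, f (x.1 i).kind = gluingStep f t.kind := by
  have hprod : ∀ p : Fin 3 → ThreePartition, ∏ i, f (p i).kind = ((kinds p).map f).prod :=
    fun p => by rw [kinds, Multiset.map_map]; rfl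
  rw [← sum_gluingKinds, ← map_kinds_gluings, Multiset.map_map]
  simp only [hprod]
  rfl

namespace HanoiGen

theorem selfLetter_bijective : Function.Bijective selfLetter := by
  constructor
  · intro g h
    cases g <;> cases h <;> simp [selfLetter]
  · intro k
    fin_cases k
    exacts [⟨.c, rfl⟩, ⟨.b, rfl⟩, ⟨.a, rfl⟩]

theorem rootPerm_selfLetter (g : HanoiGen) : g.rootPerm g.selfLetter = g.selfLetter := by
  cases g <;> decide

theorem ne_and_rootPerm_eq_iff (g : HanoiGen) {x y : Fin 3} :
    x ≠ y ∧ g.rootPerm x = y ↔ s(x, y) = s(g.selfLetter + 1, g.selfLetter + 2) := by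
  cases g <;> revert x y <;> simp only [rootPerm, selfLetter] <;> decide

theorem act_append_singleton (g : HanoiGen) (w : List (Fin 3)) (y : Fin 3) :
    g.act (w ++ [y]) = if w = List.replicate w.length g.selfLetter then w ++ [g.rootPerm y]
      else g.act w ++ [y] := by
  induction w with
  | nil => simp [act]
  | cons x w ih =>
    by_cases hx : x = g.selfLetter
    · subst hx
      simp only [List.cons_append, act, if_true, ih, rootPerm_selfLetter, List.length_cons,
        List.replicate_succ, List.cons.injEq, true_and]
      split_ifs <;> rfl
    · simp [act, hx, List.replicate_succ]

variable (g : HanoiGen) {n : ℕ}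

theorem levelAct_snoc_of_ne {w : List.Vector (Fin 3) n} (h : w ≠ hanoiCorner n g.selfLetter)
    (y : Fin 3) : g.levelAct (w.snoc y) = (g.levelAct w).snoc y := by
  refine Subtype.ext ((g.act_append_singleton w.1 y).trans (if_neg fun hw => h ?_))
  exact Subtype.ext (hw.trans (congrArg (List.replicate · _) w.2))

theorem levelAct_hanoiCorner_snoc (y : Fin 3) :
    g.levelAct ((hanoiCorner n g.selfLetter).snoc y) =
      (hanoiCorner n g.selfLetter).snoc (g.rootPerm y) := by
  refine Subtype.ext ((g.act_append_singleton _ y).trans (if_pos ?_))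
  exact congrArg (List.replicate · _) (List.length_replicate ..).symm

theorem levelAct_hanoiCorner :
    g.levelAct (hanoiCorner n g.selfLetter) = hanoiCorner n g.selfLetter := by
  cases n with
  | zero => exact Subsingleton.elim _ _
  | succ n =>
    rw [hanoiCorner, List.Vector.replicate_succ_to_snoc, ← hanoiCorner, levelAct_hanoiCorner_snoc,
      rootPerm_selfLetter]

end HanoiGen

section SelfSimilarity

variable {n : ℕ}

/-- A word of length `n + 1` is its last letter together with the word of length `n` before it; the
last letter is the index of the copy of `Σ_n` in `Σ_(n + 1)` which contains the word. -/
noncomputable def snocEquiv (n : ℕ) : Fin 3 × List.Vector (Fin 3) n ≃ List.Vector (Fin 3) (n + 1) :=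
  Equiv.ofBijective (fun x => x.2.snoc x.1) <| by
    constructor
    · rintro ⟨x, v, hv⟩ ⟨y, w, hw⟩ h
      obtain ⟨rfl, hxy⟩ := List.append_inj' (congrArg Subtype.val h) rfl
      exact Prod.ext (List.singleton_inj.1 hxy) rfl
    · rintro ⟨l, hl⟩
      have hne : l ≠ [] := List.ne_nil_of_length_eq_add_one hl
      exact ⟨(l.getLast hne, ⟨l.dropLast, by simp [hl]⟩),
        Subtype.ext (List.dropLast_append_getLast hne)⟩

theorem snocEquiv_hanoiCorner (i : Fin 3) :
    snocEquiv n (i, hanoiCorner n i) = hanoiCorner (n + 1) i :=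
  (List.Vector.replicate_succ_to_snoc i).symm

theorem glue_hanoiGraph_adj_iff {x y : Fin 3 × List.Vector (Fin 3) n} :
    (glue (hanoiCorner n) (fun _ => hanoiGraph n) Finset.univ).Adj x y ↔
      (hanoiGraph (n + 1)).Adj (snocEquiv n x) (snocEquiv n y) := by
  obtain ⟨x, u⟩ := x
  obtain ⟨y, v⟩ := y
  have hinj {x y : Fin 3} {u v : List.Vector (Fin 3) n} : u.snoc x = v.snoc y ↔ x = y ∧ u = v :=
    ((snocEquiv n).injective.eq_iff (a := (x, u)) (b := (y, v))).trans Prod.mk_inj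
  rw [glue_adj]
  change (x = y ∧ u ≠ v ∧ ∃ g : HanoiGen, g.levelAct u = v) ∨ _ ↔
    (u.snoc x ≠ v.snoc y ∧ ∃ g : HanoiGen, g.levelAct (u.snoc x) = v.snoc y)
  constructor
  · rintro (⟨rfl, hne, g, hg⟩ | ⟨k, -, h⟩)
    · refine ⟨fun h => hne (hinj.1 h).2, g, ?_⟩
      rw [g.levelAct_snoc_of_ne, hg]
      rintro rfl
      exact hne (g.levelAct_hanoiCorner.symm.trans hg)
    · obtain ⟨g, rfl⟩ := HanoiGen.selfLetter_bijective.surjective k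
      have hxy := g.ne_and_rootPerm_eq_iff.2 (congrArg (Sym2.map Prod.fst) h)
      have huv : s(u, v) = s(hanoiCorner n g.selfLetter, hanoiCorner n g.selfLetter) :=
        congrArg (Sym2.map Prod.snd) h
      obtain ⟨rfl, rfl⟩ : u = _ ∧ v = _ := by simpa using huv
      exact ⟨fun h => hxy.1 (hinj.1 h).1, g, by rw [g.levelAct_hanoiCorner_snoc, hxy.2]⟩
  · rintro ⟨hne, g, hg⟩
    by_cases hu : u = hanoiCorner n g.selfLetter
    · subst hu
      rw [g.levelAct_hanoiCorner_snoc] at hg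
      obtain ⟨hxy, rfl⟩ := hinj.1 hg
      have hne' : x ≠ y := fun h => hne (hinj.2 ⟨h, rfl⟩)
      refine .inr ⟨g.selfLetter, Finset.mem_univ _, ?_⟩
      exact congrArg (Sym2.map (·, hanoiCorner n g.selfLetter))
        (g.ne_and_rootPerm_eq_iff.1 ⟨hne', hxy⟩)
    · rw [g.levelAct_snoc_of_ne hu] at hg
      obtain ⟨rfl, hv⟩ := hinj.1 hg
      exact .inl ⟨rfl, fun h => hne (hinj.2 ⟨rfl, h⟩), g, hv⟩

/-- The self-similarity of the Schreier graphs: `Σ_(n + 1)` is three copies of `Σ_n` glued along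
three bridges. -/
noncomputable def glueHanoiGraphIso (n : ℕ) :
    glue (hanoiCorner n) (fun _ => hanoiGraph n) Finset.univ ≃g hanoiGraph (n + 1) where
  toEquiv := snocEquiv n
  map_rel_iff' := glue_hanoiGraph_adj_iff.symm

theorem ncard_groves_hanoiGraph_zero (p : ThreePartition) :
    (groves (hanoiGraph 0) (hanoiCorner 0) p.rel).ncard = ![1, 0, 0] p.kind := by
  have hreach (F : SimpleGraph (List.Vector (Fin 3) 0)) (u v) : F.Reachable u v :=
    Subsingleton.elim u v ▸ .rfl
  have hrel (F) : nodeRel F (hanoiCorner 0) = ThreePartition.joined.rel :=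
    funext₂ fun i j => eq_true (hreach F _ _)
  have hempty (hp : p ≠ .joined) : (groves (hanoiGraph 0) (hanoiCorner 0) p.rel).ncard = 0 := by
    rw [Set.ncard_eq_zero, Set.eq_empty_iff_forall_notMem]
    exact fun F hF => hp (ThreePartition.rel_injective (hF.2.2.2.symm.trans (hrel F)))
  cases p with
  | joined =>
    refine Set.ncard_eq_one.2 ⟨⊥, Set.eq_singleton_iff_unique_mem.2 ⟨?_, fun F _ => ?_⟩⟩
    · exact ⟨bot_le, .of_subsingleton, fun v => ⟨0, hreach ..⟩, hrel ⊥⟩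
    · exact Subsingleton.elim F ⊥
  | isolating i => exact hempty nofun
  | discrete => exact hempty nofun

theorem ncard_groves_hanoiGraph (n : ℕ) (p : ThreePartition) :
    (groves (hanoiGraph n) (hanoiCorner n) p.rel).ncard = (gluingStep^[n] ![1, 0, 0]) p.kind := by
  induction n generalizing p with
  | zero => exact ncard_groves_hanoiGraph_zero p
  | succ n ih =>
    have hcorner : glueHanoiGraphIso n ∘ (fun i => (i, hanoiCorner n i)) = hanoiCorner (n + 1) :=
      funext snocEquiv_hanoiCorner
    rw [← hcorner, ← ncard_groves_congr, ncard_groves_glue, Function.iterate_succ_apply']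
    simp only [ih, sum_gluings]

end SelfSimilarity

theorem hanoiTrees_eq_groves (n : ℕ) :
    hanoiTrees n = groves (hanoiGraph n) (hanoiCorner n) ThreePartition.joined.rel := by
  ext F
  simp only [hanoiTrees, groves, Set.mem_ofPred_eq, funext_iff, ThreePartition.rel, eq_iff_iff,
    iff_true]
  refine and_congr_right fun _ => ⟨fun h => ?_, fun ⟨hacyclic, hspan, hjoined⟩ => ?_⟩
  · exact ⟨h.isAcyclic, fun v => ⟨0, h.connected.preconnected _ _⟩,
      fun i j => h.connected.preconnected _ _⟩
  · refine ⟨⟨fun u v => ?_⟩, hacyclic⟩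
    obtain ⟨i, hi⟩ := hspan u
    obtain ⟨j, hj⟩ := hspan v
    exact hi.trans ((hjoined i j).trans hj.symm)

theorem nodeRel_eq_isolating_iff {V : Type*} {F : SimpleGraph V} {κ : Fin 3 → V} {i : Fin 3} :
    nodeRel F κ = (ThreePartition.isolating i).rel ↔
      (∀ j k, j ≠ i → k ≠ i → F.Reachable (κ j) (κ k)) ∧
        ∀ j, j ≠ i → ¬ F.Reachable (κ i) (κ j) := by
  simp only [funext_iff, eq_iff_iff, nodeRel, ThreePartition.rel]
  constructor
  · intro h
    exact ⟨fun j k hj hk => (h j k).2 (by simp [hj, hk]), fun j hj => by simp [h, hj]⟩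
  · rintro ⟨hjoined, hisolated⟩ j k
    by_cases hj : j = i <;> by_cases hk : k = i
    · simp [hj, hk]
    · subst hj
      simp [hisolated k hk, hk]
    · subst hk
      simp [mt SimpleGraph.Reachable.symm (hisolated j hj), hj]
    · simp [hjoined j k hj hk, hj, hk]

theorem nodeRel_eq_discrete_iff {V : Type*} {F : SimpleGraph V} {κ : Fin 3 → V} :
    nodeRel F κ = ThreePartition.discrete.rel ↔ ∀ i j, i ≠ j → ¬ F.Reachable (κ i) (κ j) := by
  simp only [funext_iff, eq_iff_iff, nodeRel, ThreePartition.rel]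
  refine forall₂_congr fun i j => ⟨fun h => mt h.1, fun h => ?_⟩
  exact ⟨fun hr => by_contra fun hne => h hne hr, fun h => h ▸ .rfl⟩

theorem hanoiTwoForests_eq_groves (n : ℕ) (i : Fin 3) :
    hanoiTwoForests n i =
      groves (hanoiGraph n) (hanoiCorner n) (ThreePartition.isolating i).rel := by
  ext F
  rw [mem_groves_iff_isSpanningForest, nodeRel_eq_isolating_iff, ThreePartition.natCard_quot_rel]
  rfl

theorem hanoiThreeForests_eq_groves (n : ℕ) :
    hanoiThreeForests n = groves (hanoiGraph n) (hanoiCorner n) ThreePartition.discrete.rel := by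
  ext F
  rw [mem_groves_iff_isSpanningForest, nodeRel_eq_discrete_iff, ThreePartition.natCard_quot_rel]
  rfl

theorem ncard_hanoiTwoForests (n : ℕ) (i : Fin 3) : (hanoiTwoForests n i).ncard = hanoiS n := by
  simp only [hanoiS, hanoiTwoForests_eq_groves, ncard_groves_hanoiGraph, ThreePartition.kind]

theorem hanoiCounts_eq (n : ℕ) :
    ![hanoiTau n, hanoiS n, hanoiQCount n] = gluingStep^[n] ![1, 0, 0] := by
  simp only [hanoiTau, hanoiS, hanoiQCount, hanoiTrees_eq_groves, hanoiTwoForests_eq_groves,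
    hanoiThreeForests_eq_groves, ncard_groves_hanoiGraph, ThreePartition.kind]
  ext k
  fin_cases k <;> rfl

theorem hanoiCounts_succ (n : ℕ) :
    ![hanoiTau (n + 1), hanoiS (n + 1), hanoiQCount (n + 1)] =
      gluingStep ![hanoiTau n, hanoiS n, hanoiQCount n] := by
  rw [hanoiCounts_eq, hanoiCounts_eq, Function.iterate_succ_apply']

theorem hanoiWeight_one_one_one {n : ℕ} {e : Sym2 (List.Vector (Fin 3) n)}
    (he : e ∈ (hanoiGraph n).edgeSet) : hanoiWeight n 1 1 1 e = 1 := by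
  induction e with
  | h u v =>
    obtain ⟨-, g, rfl⟩ : (hanoiGraph n).Adj u v := he
    unfold hanoiWeight
    split_ifs with ha hb hc
    · rfl
    · rfl
    · rfl
    · cases g
      exacts [absurd ⟨u, rfl⟩ ha, absurd ⟨u, rfl⟩ hb, absurd ⟨u, rfl⟩ hc]

open Classical in
theorem hanoiGenFun_one_one_one {n : ℕ} {𝓕 : Set (SimpleGraph (List.Vector (Fin 3) n))}
    (h𝓕 : ∀ F ∈ 𝓕, F ≤ hanoiGraph n) : hanoiGenFun n 𝓕 1 1 1 = 𝓕.ncard := by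
  have hweight : ∀ F ∈ Finset.univ.filter (· ∈ 𝓕),
      ∏ e ∈ F.edgeFinset, hanoiWeight n 1 1 1 e = 1 := fun F hF =>
    Finset.prod_eq_one fun e he => hanoiWeight_one_one_one <|
      SimpleGraph.edgeSet_mono (h𝓕 F (Finset.mem_filter.1 hF).2) (SimpleGraph.mem_edgeFinset.1 he)
  rw [hanoiGenFun, Finset.sum_congr rfl hweight, Set.ncard_eq_toFinset_card', Set.toFinset]
  simp

theorem mainTheorem12 :
    (∀ n : ℕ, 1 ≤ n →
      hanoiT n 1 1 1 = hanoiTau n ∧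
      hanoiU n 1 1 1 = hanoiS n ∧ hanoiR n 1 1 1 = hanoiS n ∧ hanoiL n 1 1 1 = hanoiS n ∧
      (∀ i : Fin 3, (hanoiTwoForests n i).ncard = hanoiS n) ∧
      hanoiQ n 1 1 1 = hanoiQCount n ∧
      hanoiTau (n + 1) = 3 * hanoiTau n ^ 3 + 6 * hanoiTau n ^ 2 * hanoiS n ∧
      hanoiS (n + 1) = hanoiTau n ^ 3 + 7 * hanoiTau n ^ 2 * hanoiS n
        + 7 * hanoiTau n * hanoiS n ^ 2 + hanoiTau n ^ 2 * hanoiQCount n ∧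
      hanoiQCount (n + 1) = 3 * hanoiTau n ^ 2 * hanoiQCount n
        + 12 * hanoiTau n * hanoiS n * hanoiQCount n + 14 * hanoiS n ^ 3
        + 12 * hanoiTau n ^ 2 * hanoiS n + hanoiTau n ^ 3 + 36 * hanoiTau n * hanoiS n ^ 2) ∧
    hanoiTau 1 = 3 ∧ hanoiS 1 = 1 ∧ hanoiQCount 1 = 1 := by
  have htwo : ∀ n i, hanoiGenFun n (hanoiTwoForests n i) 1 1 1 = hanoiS n := fun n i => by
    rw [hanoiGenFun_one_one_one fun F hF => hF.1.1, ncard_hanoiTwoForests]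
  have hsucc (n : ℕ) (k : Fin 3) := congrFun (hanoiCounts_succ n) k
  have hone (k : Fin 3) := congrFun (hanoiCounts_eq 1) k
  refine ⟨fun n _ => ⟨?_, htwo n 1, htwo n 2, htwo n 0, ncard_hanoiTwoForests n, ?_,
    hsucc n 0, hsucc n 1, hsucc n 2⟩, hone 0, hone 1, hone 2⟩
  · exact hanoiGenFun_one_one_one fun F hF => hF.1
  · exact hanoiGenFun_one_one_one fun F hF => hF.1.1
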